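/- Let $K$ be a field and let $E=(E^0,E^1,\mathbf{s},\mathbf{r})$ be a directed graph (with arbitrary sets of vertices $E^0$ and edges $E^1$). A vertex $v$ is regular if $\mathbf{s}^{-1}(v)$ is nonempty and finite. Paths are the vertices (paths of length $0$, with $v^*=v$ and $\mathbf r(v)=v$) and the finite sequences $p=e_1\cdots e_n$ of edges, $n\ge 1$, with $\mathbf{r}(e_i)=\mathbf{s}(e_{i+1})$; for these $|p|=n$, $\mathbf{r}(p)=\mathbf{r}(e_n)$ and $p^*=e_n^*\cdots e_1^*$. The Leavitt path algebra $L_K(E)$ is the free (associative, not necessarily unital) $K$-algebra generated by $E^0\cup E^1\cup\{e^*\mid e\in E^1\}$ subject to the relations, for all $v,w\in E^0$ and $e,f\in E^1$: $vw=\delta_{v,w}v$; $\mathbf{s}(e)e=e\mathbf{r}(e)=e$; $\mathbf{r}(e)e^*=e^*\mathbf{s}(e)=e^*$; $e^*f=\delta_{e,f}\mathbf{r}(e)$; and $v=\sum_{e\in\mathbf{s}^{-1}(v)}ee^*$ for every regular vertex $v$. Let $R$ be an associative, not necessarily unital, $K$-algebra. An $R$-valued graph trace on $E$ is a map $\delta:E^0\to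 R$ such that $\delta(v)=\sum_{e\in\mathbf{s}^{-1}(v)}\delta(\mathbf{r}(e))$ for all regular vertices $v$. An $R$-valued trace on $L_K(E)$ is an additive map $t:L_K(E)\to R$ such that $t(xy)=t(yx)$ for all $x,y\in L_K(E)$; it is $K$-linear if $t(cx)=ct(x)$ for all $c\in K$ and $x\in L_K(E)$, and canonical if $$t(pq^*)=\delta_{|p|,|q|}t(pq^*)=\delta_{p,q}t(pq^*)=\delta_{p,q}t(\mathbf{r}(p))$$ for all paths $p$ and $q$. Then there is a bijection $\tau$ from the set of $R$-valued graph traces on $E$ onto the set of canonical, $K$-linear, $R$-valued traces on $L_K(E)$ such that, for every graph trace $\delta$, the trace $\tau(\delta)$ extends $\delta$, that is, $\tau(\delta)(v)=\delta(v)$ for every vertex $v$, and moreover $\tau(\delta)(pq^*)=\delta_{p,q}\,\delta(\mathbf{r}(p))$ for all paths $p$ and $q$. -/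

import Mathlib

/-- A directed graph `E = (E⁰, E¹, s, r)`: arbitrary types of vertices and of edges, with the
source and range maps. -/
structure DirGraph.{u, v} where
  /-- the vertices -/
  Vert : Type u
  /-- the edges -/
  Edge : Type v
  /-- the source map -/
  src : Edge → Vert
  /-- the range map -/
  rng : Edge → Vert

namespace DirGraph

/-- The set `s⁻¹(v)` of edges emitted by `v`. -/
def emits (E : DirGraph) (v : E.Vert) : Set E.Edge := {e | E.src e = v}

/-- A vertex is regular if it emits at least one and only finitely many edges. -/
def IsRegular (E : DirGraph) (v : E.Vert) : Prop := (E.emits v).Nonempty ∧ (E.emits v).Finite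

/-- The finset of edges emitted by a regular vertex. -/
noncomputable def IsRegular.edges {E : DirGraph} {v : E.Vert} (h : E.IsRegular v) :
    Finset E.Edge := h.2.toFinset

/-- `E.IsWalk v [e₁, …, eₙ]` says that `s(e₁) = v` (if `n ≥ 1`) and `r(eᵢ) = s(eᵢ₊₁)` for all
`i < n`. -/
def IsWalk (E : DirGraph) : E.Vert → List E.Edge → Prop
  | _, [] => True
  | v, e :: l => E.src e = v ∧ E.IsWalk (E.rng e) l

/-- The vertex at which the edges of the list, followed from `v`, end. -/
def walkEnd (E : DirGraph) : E.Vert → List E.Edge → E.Vert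
  | v, [] => v
  | _, e :: l => E.walkEnd (E.rng e) l

/-- A path: a source vertex with a list of composable edges that starts there. Paths of length
zero are the vertices; a path of positive length is determined by its edges. -/
@[ext] structure Path (E : DirGraph) where
  /-- the source `s(p)` -/
  src : E.Vert
  /-- the edges of the path, in order -/
  edges : List E.Edge
  isWalk : E.IsWalk src edges

/-- The length `|p|`. -/
def Path.length {E : DirGraph} (p : E.Path) : ℕ := p.edges.length

/-- The range `r(p)`. -/
def Path.rng {E : DirGraph} (p : E.Path) : E.Vert := E.walkEnd p.src p.edges

/-- The generators `E⁰ ∪ E¹ ∪ {e* | e ∈ E¹}` (a disjoint union). -/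
inductive Gen (E : DirGraph)
  | vertex (v : E.Vert)
  | edge (e : E.Edge)
  | ghost (e : E.Edge)

end DirGraph

/-- The free associative, not necessarily unital, `K`-algebra on a set `X`: the semigroup algebra
of the free semigroup (of nonempty words) on `X`. -/
abbrev FreeNonUnitalAlg (K : Type*) [Field K] (X : Type*) : Type _ :=
  MonoidAlgebra K (FreeSemigroup X)

/-- A generator, as an element of the free algebra. -/
noncomputable def FreeNonUnitalAlg.gen (K : Type*) [Field K] {X : Type*} (x : X) :
    FreeNonUnitalAlg K X :=
  MonoidAlgebra.single (FreeSemigroup.of x) 1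

namespace LPA

open DirGraph FreeNonUnitalAlg

open Classical in
/-- The defining relations of the Leavitt path algebra, between elements of the free algebra on
the generators. -/
inductive Rel (K : Type*) [Field K] (E : DirGraph) :
    FreeNonUnitalAlg K E.Gen → FreeNonUnitalAlg K E.Gen → Prop
  /-- (V) `v w = δ_{v,w} v` -/
  | V (v w : E.Vert) :
      Rel K E (gen K (Gen.vertex v) * gen K (Gen.vertex w))
        (if v = w then gen K (Gen.vertex v) else 0)
  /-- (E1) `s(e) e = e` -/
  | E1_left (e : E.Edge) :
      Rel K E (gen K (Gen.vertex (E.src e)) * gen K (Gen.edge e)) (gen K (Gen.edge e))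
  /-- (E1) `e r(e) = e` -/
  | E1_right (e : E.Edge) :
      Rel K E (gen K (Gen.edge e) * gen K (Gen.vertex (E.rng e))) (gen K (Gen.edge e))
  /-- (E2) `r(e) e* = e*` -/
  | E2_left (e : E.Edge) :
      Rel K E (gen K (Gen.vertex (E.rng e)) * gen K (Gen.ghost e)) (gen K (Gen.ghost e))
  /-- (E2) `e* s(e) = e*` -/
  | E2_right (e : E.Edge) :
      Rel K E (gen K (Gen.ghost e) * gen K (Gen.vertex (E.src e))) (gen K (Gen.ghost e))
  /-- (CK1) `e* f = δ_{e,f} r(e)` -/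
  | CK1 (e f : E.Edge) :
      Rel K E (gen K (Gen.ghost e) * gen K (Gen.edge f))
        (if e = f then gen K (Gen.vertex (E.rng e)) else 0)
  /-- (CK2) `v = ∑_{e ∈ s⁻¹(v)} e e*` for every regular vertex `v` -/
  | CK2 (v : E.Vert) (h : E.IsRegular v) :
      Rel K E (gen K (Gen.vertex v)) (∑ e ∈ h.edges, gen K (Gen.edge e) * gen K (Gen.ghost e))

/-- The scalar multiples of the defining relations. (Without a unit, a congruence of rings need
not respect scalars, so the relations are made stable under scalars first.) -/
inductive SMulRel (K : Type*) [Field K] (E : DirGraph) :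
    FreeNonUnitalAlg K E.Gen → FreeNonUnitalAlg K E.Gen → Prop
  | smul (a : K) {x y : FreeNonUnitalAlg K E.Gen} (h : Rel K E x y) : SMulRel K E (a • x) (a • y)

/-- The congruence of `K`-algebras generated by the defining relations. -/
noncomputable def con (K : Type*) [Field K] (E : DirGraph) : RingCon (FreeNonUnitalAlg K E.Gen) :=
  ringConGen (SMulRel K E)

theorem con_smul {K : Type*} [Field K] {E : DirGraph} (a : K) {x y : FreeNonUnitalAlg K E.Gen}
    (h : con K E x y) : con K E (a • x) (a • y) := by
  change RingConGen.Rel (SMulRel K E) x y at h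
  change RingConGen.Rel (SMulRel K E) (a • x) (a • y)
  induction h with
  | of x y h =>
    obtain ⟨b, h⟩ := h
    rw [smul_smul, smul_smul]
    exact .of _ _ (.smul _ h)
  | refl x => exact .refl _
  | symm _ ih => exact .symm ih
  | trans _ _ ih₁ ih₂ => exact .trans ih₁ ih₂
  | add _ _ ih₁ ih₂ =>
    rw [smul_add, smul_add]
    exact .add ih₁ ih₂
  | mul _ h₂ ih₁ _ =>
    rw [← smul_mul_assoc, ← smul_mul_assoc]
    exact .mul ih₁ h₂

end LPA

/-- The Leavitt path algebra `L_K(E)`: the free (associative, not necessarily unital) `K`-algebra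
on `E⁰ ∪ E¹ ∪ {e* | e ∈ E¹}` modulo the relations (V), (E1), (E2), (CK1), (CK2). -/
def LPA (K : Type*) [Field K] (E : DirGraph) : Type _ := (LPA.con K E).Quotient

namespace LPA

open DirGraph FreeNonUnitalAlg

section Algebra

variable (K : Type*) [Field K] (E : DirGraph)

noncomputable instance : NonUnitalRing (LPA K E) :=
  inferInstanceAs (NonUnitalRing (LPA.con K E).Quotient)

/-- The quotient map from the free algebra. -/
noncomputable def mk (x : FreeNonUnitalAlg K E.Gen) : LPA K E := (x : (LPA.con K E).Quotient)

noncomputable instance : SMul K (LPA K E) where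
  smul a := Quotient.map' (a • ·) fun _ _ h => con_smul a h

noncomputable instance : Module K (LPA K E) where
  one_smul := Quotient.ind' fun x => congrArg (mk K E) (one_smul K x)
  mul_smul a b := Quotient.ind' fun x => congrArg (mk K E) (mul_smul a b x)
  smul_zero a := congrArg (mk K E) (smul_zero a)
  smul_add a := Quotient.ind₂' fun x y => congrArg (mk K E) (smul_add a x y)
  add_smul a b := Quotient.ind' fun x => congrArg (mk K E) (add_smul a b x)
  zero_smul := Quotient.ind' fun x => congrArg (mk K E) (zero_smul K x)

instance : IsScalarTower K (LPA K E) (LPA K E) where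
  smul_assoc a := Quotient.ind₂' fun x y => congrArg (mk K E) (smul_mul_assoc a x y)

instance : SMulCommClass K (LPA K E) (LPA K E) where
  smul_comm a := Quotient.ind₂' fun x y => congrArg (mk K E) (mul_smul_comm a x y).symm

end Algebra

section Elements

variable (K : Type*) [Field K] {E : DirGraph}

/-- The vertex `v` as an element of `L_K(E)`. -/
noncomputable def vertex (v : E.Vert) : LPA K E := mk K E (gen K (Gen.vertex v))

/-- The edge `e` as an element of `L_K(E)`. -/
noncomputable def edge (e : E.Edge) : LPA K E := mk K E (gen K (Gen.edge e))

/-- The ghost edge `e*` as an element of `L_K(E)`. -/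
noncomputable def ghost (e : E.Edge) : LPA K E := mk K E (gen K (Gen.ghost e))

/-- The product `e₁ ⋯ eₙ · w`, where `w` is the vertex at which the list ends. -/
noncomputable def walkElem : E.Vert → List E.Edge → LPA K E
  | v, [] => vertex K v
  | _, e :: l => edge K e * walkElem (E.rng e) l

/-- The product `w · eₙ* ⋯ e₁*`, where `w` is the vertex at which the list ends. -/
noncomputable def ghostWalkElem : E.Vert → List E.Edge → LPA K E
  | v, [] => vertex K v
  | _, e :: l => ghostWalkElem (E.rng e) l * ghost K e

/-- The path `p` as an element of `L_K(E)`: a vertex, if `p` has length zero, and the product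
`e₁ ⋯ eₙ = e₁ ⋯ eₙ r(eₙ)` otherwise. -/
noncomputable def path (p : E.Path) : LPA K E := walkElem K p.src p.edges

/-- The ghost path `p*` as an element of `L_K(E)`: `v* = v` for a vertex `v`, and
`(e₁ ⋯ eₙ)* = eₙ* ⋯ e₁* = r(eₙ) eₙ* ⋯ e₁*`. -/
noncomputable def ghostPath (p : E.Path) : LPA K E := ghostWalkElem K p.src p.edges

end Elements

end LPA

/-- An `R`-valued graph trace on `E`: a map `δ : E⁰ → R` with `δ(v) = ∑_{e ∈ s⁻¹(v)} δ(r(e))` for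
all regular vertices `v`. -/
def IsGraphTrace (E : DirGraph) {R : Type*} [NonUnitalRing R] (δ : E.Vert → R) : Prop :=
  ∀ (v : E.Vert) (h : E.IsRegular v), δ v = ∑ e ∈ h.edges, δ (E.rng e)

/-- A trace: an additive and central map between rings. -/
structure IsTrace {A R : Type*} [NonUnitalRing A] [NonUnitalRing R] (t : A → R) : Prop where
  map_add : ∀ x y, t (x + y) = t x + t y
  central : ∀ x y, t (x * y) = t (y * x)

open Classical in
/-- A map on `L_K(E)` is canonical if
`t(pq*) = δ_{|p|,|q|} t(pq*) = δ_{p,q} t(pq*) = δ_{p,q} t(r(p))` for all paths `p` and `q`. -/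
def IsCanonical {K : Type*} [Field K] {E : DirGraph} {R : Type*} [NonUnitalRing R]
    (t : LPA K E → R) : Prop :=
  ∀ p q : E.Path,
    t (LPA.path K p * LPA.ghostPath K q) =
        (if p.length = q.length then t (LPA.path K p * LPA.ghostPath K q) else 0) ∧
    t (LPA.path K p * LPA.ghostPath K q) =
        (if p = q then t (LPA.path K p * LPA.ghostPath K q) else 0) ∧
    t (LPA.path K p * LPA.ghostPath K q) =
        (if p = q then t (LPA.vertex K p.rng) else 0)

/-- The `R`-valued graph traces on `E`. -/
def GraphTrace (E : DirGraph) (R : Type*) [NonUnitalRing R] : Type _ :=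
  {δ : E.Vert → R // IsGraphTrace E δ}

/-- The canonical, `K`-linear, `R`-valued traces on `L_K(E)`. -/
def CanonicalTrace (K : Type*) [Field K] (E : DirGraph) (R : Type*) [NonUnitalRing R]
    [Module K R] : Type _ :=
  {t : LPA K E → R // IsTrace t ∧ (∀ (a : K) (x : LPA K E), t (a • x) = a • t x) ∧ IsCanonical t}

/-! ### Walks, rays of edge sequences, and their values under a graph trace. -/

namespace DirGraph

variable {E : DirGraph}

/-! One direction is short. A trace has t(ee*) = t(e*e) = t(r(e)), so (CK2) makes its values on
vertices a graph trace. Every word in the generators is zero or some pq* in L_K(E), so a canonical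
linear trace is determined by those values.

The work is to construct a trace from δ. The elements pq* may be linearly dependent, so a value
cannot simply be prescribed on each of them. Instead, words of the free algebra act on finite
sequences of edges by replacing prefixes: pq* sends qz to pz. Cancelling z shows that pq* has no
fixed points if p ≠ q, while pp* fixes exactly the ray of extensions of p. `freeTrace` gives a word
the value δ(r(p)) if its fixed points form the ray of p, and 0 if they form no ray.

This value is central because B carries the fixed points of AB onto those of BA, rays to rays with
the same end vertex (`SeqRel.fixed_mul_comm_ray`). All defining relations except (CK2) hold for the
action itself. (CK2) does not, since the empty sequence at v extends no edge, but it holds after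
evaluation because δ is a graph trace (`rayValue_fixed_mul_vertex`). Centrality then extends this
from the defining relations to the congruence they generate (`traceEq_of_con`). -/

theorem isWalk_append {v : E.Vert} {l m : List E.Edge} :
    E.IsWalk v (l ++ m) ↔ E.IsWalk v l ∧ E.IsWalk (E.walkEnd v l) m := by
  induction l generalizing v with
  | nil => simp [IsWalk, walkEnd]
  | cons e l ih => simp [IsWalk, walkEnd, ih, and_assoc]

theorem walkEnd_append (v : E.Vert) (l m : List E.Edge) :
    E.walkEnd v (l ++ m) = E.walkEnd (E.walkEnd v l) m := by
  induction l generalizing v with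
  | nil => rfl
  | cons e l ih => exact ih _

/-- The sequences that extend a given sequence of edges. -/
def ray (E : DirGraph) (x : E.Vert × List E.Edge) : Set (E.Vert × List E.Edge) :=
  {y | y.1 = x.1 ∧ x.2 <+: y.2}

theorem mem_ray {x y : E.Vert × List E.Edge} : y ∈ E.ray x ↔ ∃ z, y = (x.1, x.2 ++ z) := by
  constructor
  · rintro ⟨h, z, hz⟩
    exact ⟨z, Prod.ext h hz.symm⟩
  · rintro ⟨z, rfl⟩
    exact ⟨rfl, z, rfl⟩

theorem self_mem_ray (x : E.Vert × List E.Edge) : x ∈ E.ray x := ⟨rfl, List.prefix_rfl⟩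

/-- A ray has a shortest element, its origin. Hence the choice made in `rayValue` is harmless. -/
theorem ray_injective : Function.Injective E.ray := by
  intro x y h
  have h₁ : x ∈ E.ray y := h ▸ self_mem_ray x
  have h₂ : y ∈ E.ray x := h ▸ self_mem_ray y
  exact Prod.ext h₁.1 (h₂.2.eq_of_length_le h₁.2.length_le)

open Classical in
/-- The value of `δ` at the end of the minimal element, if the set is a ray, and `0` otherwise. -/
noncomputable def rayValue {R : Type*} [Zero R] (δ : E.Vert → R)
    (S : Set (E.Vert × List E.Edge)) : R :=
  if h : ∃ x, S = E.ray x then δ (E.walkEnd h.choose.1 h.choose.2) else 0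

section RayValue

variable {R : Type*}

theorem rayValue_ray [Zero R] (δ : E.Vert → R) (x : E.Vert × List E.Edge) :
    rayValue δ (E.ray x) = δ (E.walkEnd x.1 x.2) := by
  have h : ∃ y, E.ray x = E.ray y := ⟨x, rfl⟩
  rw [rayValue, dif_pos h, ← ray_injective h.choose_spec]

theorem rayValue_of_not [Zero R] (δ : E.Vert → R) {S : Set (E.Vert × List E.Edge)}
    (h : ¬ ∃ x, S = E.ray x) : rayValue δ S = 0 :=
  dif_neg h

@[simp] theorem rayValue_empty [Zero R] (δ : E.Vert → R) : rayValue δ ∅ = 0 :=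
  rayValue_of_not δ fun ⟨x, h⟩ => (h ▸ self_mem_ray x : x ∈ (∅ : Set _))

/-- This is (CK2) seen through `rayValue`. If p is the vertex v, it is the graph trace identity; if
p has positive length and starts at v, only its first edge contributes; if p starts elsewhere, both
sides vanish. -/
theorem rayValue_inter_vertex [NonUnitalRing R] {δ : E.Vert → R} (hδ : IsGraphTrace E δ)
    (p : E.Path) {v : E.Vert} (hv : E.IsRegular v) :
    rayValue δ (E.ray (p.src, p.edges) ∩ E.ray (v, [])) =
      ∑ e ∈ hv.edges, rayValue δ (E.ray (p.src, p.edges) ∩ E.ray (E.src e, [e])) := by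
  classical
  obtain ⟨u, l, hl⟩ := p
  have hmem : ∀ e, e ∈ hv.edges ↔ E.src e = v := fun e => hv.2.mem_toFinset
  by_cases huv : u = v
  · subst huv
    have h₁ : E.ray (u, l) ∩ E.ray (u, []) = E.ray (u, l) :=
      Set.inter_eq_left.2 fun y hy => ⟨hy.1, List.nil_prefix⟩
    rw [h₁, rayValue_ray]
    cases l with
    | nil =>
      refine (hδ u hv).trans (Finset.sum_congr rfl fun e he => ?_)
      have h₂ : E.ray (u, []) ∩ E.ray (E.src e, [e]) = E.ray (E.src e, [e]) :=
        Set.inter_eq_right.2 fun y hy => ⟨hy.1.trans ((hmem e).1 he), List.nil_prefix⟩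
      rw [h₂, rayValue_ray]
      rfl
    | cons f l =>
      rw [Finset.sum_eq_single f]
      · have h₂ : E.ray (u, f :: l) ∩ E.ray (E.src f, [f]) = E.ray (u, f :: l) :=
          Set.inter_eq_left.2 fun y hy =>
            ⟨hy.1.trans hl.1.symm, List.IsPrefix.trans ⟨l, rfl⟩ hy.2⟩
        rw [h₂, rayValue_ray]
      · intro e _ hef
        have h₂ : E.ray (u, f :: l) ∩ E.ray (E.src e, [e]) = ∅ := by
          refine Set.eq_empty_of_forall_notMem ?_
          rintro y ⟨⟨_, z, hz⟩, _, z', hz'⟩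
          rw [← hz] at hz'
          exact hef (List.cons.inj hz').1
        rw [h₂, rayValue_empty]
      · exact fun h => absurd ((hmem f).2 hl.1) h
  · have h₁ : E.ray (u, l) ∩ E.ray (v, []) = ∅ :=
      Set.eq_empty_of_forall_notMem fun y hy => huv (hy.1.1.symm.trans hy.2.1)
    rw [h₁, rayValue_empty]
    refine (Finset.sum_eq_zero fun e he => ?_).symm
    have h₂ : E.ray (u, l) ∩ E.ray (E.src e, [e]) = ∅ :=
      Set.eq_empty_of_forall_notMem fun y hy =>
        huv (hy.1.1.symm.trans (hy.2.1.trans ((hmem e).1 he)))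
    rw [h₂, rayValue_empty]

end RayValue

/-! ### The semigroup of relations, and fixed points of monomials. -/

/-- Relations between sequences of edges; `A y x` is read as `y = A x`. -/
def SeqRel (E : DirGraph) : Type _ := E.Vert × List E.Edge → E.Vert × List E.Edge → Prop

namespace SeqRel

instance : Semigroup E.SeqRel where
  mul A B := Relation.Comp A B
  mul_assoc _ _ _ := Relation.comp_assoc

instance : Zero E.SeqRel := ⟨fun _ _ => False⟩

theorem mul_apply (A B : E.SeqRel) (x y : E.Vert × List E.Edge) :
    (A * B) x y ↔ ∃ z, A x z ∧ B z y := Iff.rfl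

@[ext] theorem ext {A B : E.SeqRel} (h : ∀ x y, A x y ↔ B x y) : A = B :=
  funext fun x => funext fun y => propext (h x y)

theorem zero_apply (x y : E.Vert × List E.Edge) : ¬ (0 : E.SeqRel) x y := id

theorem mul_zero (A : E.SeqRel) : A * 0 = 0 := by
  ext x y; simp [mul_apply, zero_apply]

/-- The relation which replaces the initial segment `q` by `p`. -/
def swap (p q : E.Vert × List E.Edge) : E.SeqRel :=
  fun y x => ∃ z, y = (p.1, p.2 ++ z) ∧ x = (q.1, q.2 ++ z)

theorem swap_mul_swap (p q : E.Vert × List E.Edge) (v : E.Vert) :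
    swap p (v, []) * swap (v, []) q = swap p q := by
  ext x y
  constructor
  · rintro ⟨_, ⟨z, rfl, rfl⟩, z', h, rfl⟩
    obtain rfl : z = z' := congrArg Prod.snd h
    exact ⟨z, rfl, rfl⟩
  · rintro ⟨z, rfl, rfl⟩
    exact ⟨(v, z), ⟨z, rfl, rfl⟩, z, rfl, rfl⟩

theorem swap_mul_swap_of_ne {v w : E.Vert} (h : v ≠ w) {p q : E.Vert × List E.Edge}
    {l m : List E.Edge} : swap p (v, l) * swap (w, m) q = 0 := by
  ext x y
  refine iff_of_false ?_ (zero_apply x y)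
  rintro ⟨_, ⟨z, _, rfl⟩, z', h', _⟩
  exact h (congrArg Prod.fst h')

/-- The fixed points. -/
def fixed (A : E.SeqRel) : Set (E.Vert × List E.Edge) := {x | A x x}

/-- Relations which are zero or the action of `pq*` for paths `p` and `q` with the same range. -/
def IsMonomial (A : E.SeqRel) : Prop :=
  A = 0 ∨ ∃ p q : E.Path, p.rng = q.rng ∧ A = swap (p.src, p.edges) (q.src, q.edges)

theorem fixed_zero : fixed (0 : E.SeqRel) = ∅ := rfl

theorem fixed_swap_self (p : E.Vert × List E.Edge) : fixed (swap p p) = E.ray p := by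
  ext x
  simp [fixed, swap, mem_ray]

/-- Cancelling z in pz = qz needs finite sequences: on infinite ones, a cycle c would fix ccc⋯. -/
theorem fixed_swap_of_ne {p q : E.Vert × List E.Edge} (h : p ≠ q) : fixed (swap p q) = ∅ := by
  refine Set.eq_empty_of_forall_notMem ?_
  rintro x ⟨z, h₁, h₂⟩
  have h₃ := h₁.symm.trans h₂
  obtain ⟨h₄, h₅⟩ := Prod.mk.inj h₃
  exact h (Prod.ext h₄ (List.append_cancel_right h₅))

theorem fixed_mul_swap_self (A : E.SeqRel) (p : E.Vert × List E.Edge) :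
    fixed (A * swap p p) = fixed A ∩ E.ray p := by
  ext x
  rw [Set.mem_inter_iff, mem_ray]
  constructor
  · rintro ⟨y, h, z, rfl, rfl⟩
    exact ⟨h, z, rfl⟩
  · rintro ⟨h, z, rfl⟩
    exact ⟨_, h, z, rfl, rfl⟩

/-- If x is fixed by AB, then Bx is fixed by BA. For B = pq* this turns the prefix q into p, and the
end vertex survives because r(p) = r(q). -/
theorem fixed_mul_comm_ray {A B : E.SeqRel} (hB : B.IsMonomial) {x : E.Vert × List E.Edge}
    (h : fixed (A * B) = E.ray x) :
    ∃ y, fixed (B * A) = E.ray y ∧ E.walkEnd y.1 y.2 = E.walkEnd x.1 x.2 := by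
  obtain rfl | ⟨p, q, hpq, rfl⟩ := hB
  · rw [mul_zero, fixed_zero] at h
    exact absurd (h ▸ self_mem_ray x : x ∈ (∅ : Set _)) id
  obtain ⟨_, _, z₀, _, hx⟩ : x ∈ fixed (A * swap (p.src, p.edges) (q.src, q.edges)) :=
    h ▸ self_mem_ray x
  subst hx
  -- The origin of the given ray is x = qz₀; its image under B is pz₀.
  refine ⟨(p.src, p.edges ++ z₀), ?_, ?_⟩
  · ext y
    rw [mem_ray]
    constructor
    · rintro ⟨x, hyx, hxy⟩
      have hx : x ∈ fixed (A * swap (p.src, p.edges) (q.src, q.edges)) := ⟨y, hxy, hyx⟩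
      rw [h, mem_ray] at hx
      obtain ⟨z, rfl⟩ := hx
      obtain ⟨z', rfl, hz'⟩ := hyx
      refine ⟨z, ?_⟩
      have h' : q.edges ++ (z₀ ++ z) = q.edges ++ z' := by
        simpa using congrArg Prod.snd hz'
      rw [← List.append_cancel_left h']
      simp
    · rintro ⟨z, rfl⟩
      have hx : (q.src, q.edges ++ z₀ ++ z) ∈
          fixed (A * swap (p.src, p.edges) (q.src, q.edges)) := by
        rw [h, mem_ray]
        exact ⟨z, rfl⟩
      obtain ⟨y', hA, z', hy', hz'⟩ := hx
      have h' : q.edges ++ (z₀ ++ z) = q.edges ++ z' := by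
        simpa using congrArg Prod.snd hz'
      rw [← List.append_cancel_left h', ← List.append_assoc] at hy'
      subst hy'
      exact ⟨_, ⟨z₀ ++ z, by simp, by simp⟩, hA⟩
  · have hpq' : E.walkEnd p.src p.edges = E.walkEnd q.src q.edges := hpq
    simp only [walkEnd_append, hpq']

theorem rayValue_fixed_mul_comm {R : Type*} [Zero R] (δ : E.Vert → R) {A B : E.SeqRel}
    (hA : A.IsMonomial) (hB : B.IsMonomial) :
    rayValue δ (fixed (A * B)) = rayValue δ (fixed (B * A)) := by
  by_cases h : ∃ x, fixed (A * B) = E.ray x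
  · obtain ⟨x, hx⟩ := h
    obtain ⟨y, hy, hxy⟩ := fixed_mul_comm_ray hB hx
    rw [hx, hy, rayValue_ray, rayValue_ray, hxy]
  · rw [rayValue_of_not δ h, rayValue_of_not]
    rintro ⟨x, hx⟩
    obtain ⟨y, hy, -⟩ := fixed_mul_comm_ray hA hx
    exact h ⟨y, hy⟩

end SeqRel

/-! ### The action of the generators, and the defining relations that it satisfies. -/

open SeqRel

/-- The action of a generator on sequences of edges. -/
def genRel : E.Gen → E.SeqRel
  | .vertex v => swap (v, []) (v, [])
  | .edge e => swap (E.src e, [e]) (E.rng e, [])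
  | .ghost e => swap (E.rng e, []) (E.src e, [e])

/-- The action of a word in the generators on sequences of edges. -/
def wordRel : FreeSemigroup E.Gen →ₙ* E.SeqRel := FreeSemigroup.lift genRel

@[simp] theorem wordRel_of (g : E.Gen) : wordRel (.of g) = genRel g := rfl

theorem vertex_mul_swap (v : E.Vert) (l : List E.Edge) (q : E.Vert × List E.Edge) :
    genRel (.vertex v) * swap (v, l) q = swap (v, l) q := by
  ext x y
  constructor
  · rintro ⟨_, ⟨z, rfl, rfl⟩, h⟩
    exact h
  · rintro ⟨z, rfl, rfl⟩
    exact ⟨(v, l ++ z), ⟨l ++ z, rfl, rfl⟩, z, rfl, rfl⟩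

theorem vertex_mul_swap_of_ne {v : E.Vert} {p : E.Vert × List E.Edge} (h : v ≠ p.1)
    (q : E.Vert × List E.Edge) : genRel (.vertex v) * swap p q = 0 :=
  swap_mul_swap_of_ne h

theorem edge_mul_swap (e : E.Edge) (l : List E.Edge) (q : E.Vert × List E.Edge) :
    genRel (.edge e) * swap (E.rng e, l) q = swap (E.src e, e :: l) q := by
  ext x y
  constructor
  · rintro ⟨_, ⟨z, rfl, rfl⟩, z', h, rfl⟩
    have h' : z = l ++ z' := congrArg Prod.snd h
    subst h'
    exact ⟨z', rfl, rfl⟩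
  · rintro ⟨z, rfl, rfl⟩
    exact ⟨(E.rng e, l ++ z), ⟨l ++ z, rfl, rfl⟩, z, rfl, rfl⟩

theorem edge_mul_swap_of_ne {e : E.Edge} {p : E.Vert × List E.Edge} (h : E.rng e ≠ p.1)
    (q : E.Vert × List E.Edge) : genRel (.edge e) * swap p q = 0 :=
  swap_mul_swap_of_ne h

theorem ghost_mul_swap_nil (e : E.Edge) (q : E.Vert × List E.Edge) :
    genRel (.ghost e) * swap (E.src e, []) q = swap (E.rng e, []) (q.1, q.2 ++ [e]) := by
  ext x y
  constructor
  · rintro ⟨_, ⟨z, rfl, rfl⟩, z', h, rfl⟩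
    have h' : e :: z = z' := congrArg Prod.snd h
    subst h'
    exact ⟨z, rfl, by simp⟩
  · rintro ⟨z, rfl, rfl⟩
    exact ⟨(E.src e, e :: z), ⟨z, rfl, rfl⟩, e :: z, rfl, by simp⟩

theorem ghost_mul_swap_nil_of_ne {e : E.Edge} {p : E.Vert × List E.Edge} (h : E.src e ≠ p.1)
    (q : E.Vert × List E.Edge) : genRel (.ghost e) * swap p q = 0 :=
  swap_mul_swap_of_ne h

theorem ghost_mul_swap_cons (e : E.Edge) (l : List E.Edge) (q : E.Vert × List E.Edge) :
    genRel (.ghost e) * swap (E.src e, e :: l) q = swap (E.rng e, l) q := by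
  ext x y
  constructor
  · rintro ⟨_, ⟨z, rfl, rfl⟩, z', h, rfl⟩
    have h' : e :: z = e :: (l ++ z') := congrArg Prod.snd h
    obtain rfl := (List.cons.inj h').2
    exact ⟨z', rfl, rfl⟩
  · rintro ⟨z, rfl, rfl⟩
    exact ⟨(E.src e, e :: (l ++ z)), ⟨l ++ z, rfl, rfl⟩, z, rfl, rfl⟩

theorem ghost_mul_swap_cons_of_ne {e f : E.Edge} (h : e ≠ f) (v : E.Vert) (l : List E.Edge)
    (q : E.Vert × List E.Edge) : genRel (.ghost e) * swap (v, f :: l) q = 0 := by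
  ext x y
  refine iff_of_false ?_ (zero_apply x y)
  rintro ⟨_, ⟨z, _, rfl⟩, z', h', _⟩
  have h' : e :: z = f :: (l ++ z') := congrArg Prod.snd h'
  exact h (List.cons.inj h').1

theorem edge_mul_ghost (e : E.Edge) :
    genRel (.edge e) * genRel (.ghost e) = swap (E.src e, [e]) (E.src e, [e]) :=
  edge_mul_swap e [] _

end DirGraph

/-! ### Words as monomials pq* in the Leavitt path algebra. -/

namespace LPA

open DirGraph FreeNonUnitalAlg

section Relations

variable (K : Type*) [Field K] {E : DirGraph}

theorem mk_mul (x y : FreeNonUnitalAlg K E.Gen) : mk K E (x * y) = mk K E x * mk K E y := rfl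

theorem mk_sum {ι : Type*} (s : Finset ι) (f : ι → FreeNonUnitalAlg K E.Gen) :
    mk K E (∑ i ∈ s, f i) = ∑ i ∈ s, mk K E (f i) :=
  map_sum (⟨⟨mk K E, rfl⟩, fun _ _ => rfl⟩ : FreeNonUnitalAlg K E.Gen →+ LPA K E) f s

theorem mk_surjective : Function.Surjective (mk K E) := Quotient.mk_surjective

theorem mk_eq_of_rel {x y : FreeNonUnitalAlg K E.Gen} (h : Rel K E x y) : mk K E x = mk K E y := by
  refine Quotient.sound (RingConGen.Rel.of x y ?_)
  simpa using SMulRel.smul (1 : K) h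

theorem vertex_mul_self (v : E.Vert) : vertex K v * vertex K v = vertex K v :=
  (mk_eq_of_rel K (Rel.V v v)).trans (congrArg (mk K E) (if_pos rfl))

theorem vertex_mul_of_ne {v w : E.Vert} (h : v ≠ w) : vertex K v * vertex K w = 0 :=
  (mk_eq_of_rel K (Rel.V v w)).trans (congrArg (mk K E) (if_neg h))

theorem src_mul_edge (e : E.Edge) : vertex K (E.src e) * edge K e = edge K e :=
  mk_eq_of_rel K (Rel.E1_left e)

theorem edge_mul_rng (e : E.Edge) : edge K e * vertex K (E.rng e) = edge K e :=
  mk_eq_of_rel K (Rel.E1_right e)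

theorem rng_mul_ghost (e : E.Edge) : vertex K (E.rng e) * ghost K e = ghost K e :=
  mk_eq_of_rel K (Rel.E2_left e)

theorem ghost_mul_src (e : E.Edge) : ghost K e * vertex K (E.src e) = ghost K e :=
  mk_eq_of_rel K (Rel.E2_right e)

theorem ghost_mul_edge (e : E.Edge) : ghost K e * edge K e = vertex K (E.rng e) :=
  (mk_eq_of_rel K (Rel.CK1 e e)).trans (congrArg (mk K E) (if_pos rfl))

theorem ghost_mul_edge_of_ne {e f : E.Edge} (h : e ≠ f) : ghost K e * edge K f = 0 :=
  (mk_eq_of_rel K (Rel.CK1 e f)).trans (congrArg (mk K E) (if_neg h))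

theorem vertex_eq_sum {v : E.Vert} (h : E.IsRegular v) :
    vertex K v = ∑ e ∈ h.edges, edge K e * ghost K e :=
  (mk_eq_of_rel K (Rel.CK2 v h)).trans (mk_sum K _ _)

theorem vertex_mul_walkElem {v : E.Vert} {l : List E.Edge} (h : E.IsWalk v l) :
    vertex K v * walkElem K v l = walkElem K v l := by
  cases l with
  | nil => exact vertex_mul_self K v
  | cons e l =>
    obtain ⟨rfl, -⟩ := h
    rw [walkElem, ← mul_assoc, src_mul_edge]

theorem vertex_mul_walkElem_of_ne {v w : E.Vert} {l : List E.Edge} (h : E.IsWalk v l)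
    (hvw : w ≠ v) : vertex K w * walkElem K v l = 0 := by
  rw [← vertex_mul_walkElem K h, ← mul_assoc, vertex_mul_of_ne K hvw, zero_mul]

/-- The recursion for ghost paths peels off the first edge, but left multiplication by e* extends q
at its last edge. -/
theorem ghostWalkElem_append (v : E.Vert) {l : List E.Edge} {e : E.Edge}
    (h : E.walkEnd v l = E.src e) :
    ghostWalkElem K v (l ++ [e]) = ghost K e * ghostWalkElem K v l := by
  induction l generalizing v with
  | nil =>
    obtain rfl : v = E.src e := h
    simp [ghostWalkElem, rng_mul_ghost, ghost_mul_src]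
  | cons f l ih => rw [List.cons_append, ghostWalkElem, ih _ h, ghostWalkElem, mul_assoc]

/-- A word in the generators, as an element of the free algebra. -/
noncomputable abbrev word (w : FreeSemigroup E.Gen) : FreeNonUnitalAlg K E.Gen :=
  MonoidAlgebra.single w 1

theorem word_mul (w w' : FreeSemigroup E.Gen) : word K w * word K w' = word K (w * w') := by
  simp [word, MonoidAlgebra.single_mul_single]

/-- A word represents a relation and an element of the algebra simultaneously as a monomial:
both are zero or both are given by `pq*`. -/
def IsMonomialPair (A : E.SeqRel) (x : LPA K E) : Prop :=
  (A = 0 ∧ x = 0) ∨ ∃ p q : E.Path, p.rng = q.rng ∧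
    A = SeqRel.swap (p.src, p.edges) (q.src, q.edges) ∧ x = path K p * ghostPath K q

/-- On both sides alike, a vertex preserves or kills pq*, an edge lengthens p or kills, and e*
removes the first edge of p or kills. If p is a vertex, e* lengthens q instead; this is where r(p) =
r(q) is needed. -/
theorem IsMonomialPair.gen_mul (g : E.Gen) {A : E.SeqRel} {x : LPA K E}
    (h : IsMonomialPair K A x) :
    IsMonomialPair K (genRel g * A) (mk K E (gen K g) * x) := by
  obtain ⟨rfl, rfl⟩ | ⟨p, q, hpq, rfl, rfl⟩ := h
  · exact .inl ⟨SeqRel.mul_zero _, mul_zero _⟩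
  obtain ⟨u, l, hl⟩ := p
  rw [← mul_assoc]
  simp only [path]
  cases g with
  | vertex v =>
    change IsMonomialPair K _ (vertex K v * _ * _)
    by_cases hv : v = u
    · subst hv
      rw [vertex_mul_walkElem K hl, vertex_mul_swap]
      exact .inr ⟨⟨v, l, hl⟩, q, hpq, rfl, rfl⟩
    · rw [vertex_mul_walkElem_of_ne K hl hv, vertex_mul_swap_of_ne hv]
      exact .inl ⟨rfl, zero_mul _⟩
  | edge e =>
    change IsMonomialPair K _ (edge K e * _ * _)
    by_cases he : E.rng e = u
    · subst he
      rw [edge_mul_swap]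
      exact .inr ⟨⟨E.src e, e :: l, rfl, hl⟩, q, hpq, rfl, rfl⟩
    · rw [← edge_mul_rng, mul_assoc (edge K e), vertex_mul_walkElem_of_ne K hl he,
        edge_mul_swap_of_ne he]
      exact .inl ⟨rfl, by simp⟩
  | ghost e =>
    change IsMonomialPair K _ (ghost K e * _ * _)
    cases l with
    | nil =>
      by_cases he : E.src e = u
      · subst he
        have hq : E.walkEnd q.src q.edges = E.src e := hpq.symm
        rw [ghost_mul_swap_nil, walkElem, ghost_mul_src]
        refine .inr ⟨⟨E.rng e, [], trivial⟩, ⟨q.src, q.edges ++ [e],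
          isWalk_append.2 ⟨q.isWalk, hq.symm, trivial⟩⟩, ?_, rfl, ?_⟩
        · simp [Path.rng, walkEnd_append, walkEnd]
        · simp only [path, ghostPath, walkElem]
          rw [ghostWalkElem_append K _ hq, ← mul_assoc, rng_mul_ghost]
      · rw [ghost_mul_swap_nil_of_ne he, walkElem, ← ghost_mul_src, mul_assoc (ghost K e),
          vertex_mul_of_ne K he]
        exact .inl ⟨rfl, by simp⟩
    | cons f l =>
      obtain ⟨rfl, hl⟩ := hl
      by_cases he : e = f
      · subst he
        rw [ghost_mul_swap_cons, walkElem, ← mul_assoc, ghost_mul_edge, vertex_mul_walkElem K hl]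
        exact .inr ⟨⟨E.rng e, l, hl⟩, q, hpq, rfl, rfl⟩
      · rw [ghost_mul_swap_cons_of_ne he, walkElem, ← mul_assoc, ghost_mul_edge_of_ne K he]
        exact .inl ⟨rfl, by simp⟩

theorem isMonomialPair_gen (g : E.Gen) : IsMonomialPair K (genRel g) (mk K E (gen K g)) := by
  cases g with
  | vertex v =>
    exact .inr ⟨⟨v, [], trivial⟩, ⟨v, [], trivial⟩, rfl, rfl, (vertex_mul_self K v).symm⟩
  | edge e =>
    refine .inr ⟨⟨E.src e, [e], rfl, trivial⟩, ⟨E.rng e, [], trivial⟩, rfl, rfl, ?_⟩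
    change edge K e = edge K e * vertex K _ * vertex K _
    rw [edge_mul_rng, edge_mul_rng]
  | ghost e =>
    refine .inr ⟨⟨E.rng e, [], trivial⟩, ⟨E.src e, [e], rfl, trivial⟩, rfl, rfl, ?_⟩
    change ghost K e = vertex K _ * (vertex K _ * ghost K e)
    rw [rng_mul_ghost, rng_mul_ghost]

theorem isMonomialPair_word (w : FreeSemigroup E.Gen) :
    IsMonomialPair K (wordRel w) (mk K E (word K w)) := by
  induction w using FreeSemigroup.recOnMul with
  | ih1 g => exact isMonomialPair_gen K g
  | ih2 g w _ hw =>
    rw [map_mul, ← word_mul, mk_mul]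
    exact hw.gen_mul K g

theorem isMonomial_wordRel (w : FreeSemigroup E.Gen) : (wordRel w).IsMonomial := by
  -- The action does not involve scalars, so any field serves.
  obtain ⟨h, -⟩ | ⟨p, q, h, h', -⟩ := isMonomialPair_word ℚ w
  · exact .inl h
  · exact .inr ⟨p, q, h, h'⟩

theorem mk_word_eq (w : FreeSemigroup E.Gen) :
    mk K E (word K w) = 0 ∨ ∃ p q : E.Path, mk K E (word K w) = path K p * ghostPath K q := by
  obtain ⟨-, h⟩ | ⟨p, q, -, -, h⟩ := isMonomialPair_word K w
  · exact .inl h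
  · exact .inr ⟨p, q, h⟩

/-- Every path is represented by a word, which acts as the path does. -/
theorem exists_word_path (p : E.Path) : ∃ w, mk K E (word K w) = path K p ∧
    wordRel w = SeqRel.swap (p.src, p.edges) (p.rng, []) := by
  obtain ⟨v, l, hl⟩ := p
  simp only [path, Path.rng]
  induction l generalizing v with
  | nil => exact ⟨.of (.vertex v), rfl, rfl⟩
  | cons e l ih =>
    obtain ⟨rfl, hl⟩ := hl
    obtain ⟨w, hw, hw'⟩ := ih _ hl
    refine ⟨.of (.edge e) * w, ?_, ?_⟩
    · rw [← word_mul, mk_mul, hw]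
      rfl
    · rw [map_mul, hw', wordRel_of, edge_mul_swap]
      rfl

theorem exists_word_ghostPath (p : E.Path) : ∃ w, mk K E (word K w) = ghostPath K p ∧
    wordRel w = SeqRel.swap (p.rng, []) (p.src, p.edges) := by
  obtain ⟨v, l, hl⟩ := p
  simp only [ghostPath, Path.rng]
  induction l using List.reverseRecOn with
  | nil => exact ⟨.of (.vertex v), rfl, rfl⟩
  | append_singleton l e ih =>
    obtain ⟨hl, he, -⟩ := isWalk_append.1 hl
    obtain ⟨w, hw, hw'⟩ := ih hl
    refine ⟨.of (.ghost e) * w, ?_, ?_⟩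
    · rw [← word_mul, mk_mul, hw, ghostWalkElem_append K v he.symm]
      rfl
    · rw [map_mul, hw', wordRel_of, ← he, ghost_mul_swap_nil, walkEnd_append]
      rfl

/-- Apply t to (CK2) and use t(ee*) = t(e*e) = t(r(e)). -/
theorem isGraphTrace_of_isTrace {R : Type*} [NonUnitalRing R] {t : LPA K E → R}
    (ht : IsTrace t) :
    IsGraphTrace E fun v => t (vertex K v) := by
  intro v hv
  have h : ∀ x : LPA K E, t x = AddMonoidHom.mk' t ht.map_add x := fun _ => rfl
  dsimp only
  rw [vertex_eq_sum K hv, h, map_sum]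
  exact Finset.sum_congr rfl fun e _ => by rw [← h, ht.central, ghost_mul_edge]

end Relations

end LPA

/-! ### The trace on the free algebra, and its compatibility with the relations. -/

namespace LPA

open DirGraph FreeNonUnitalAlg

section Trace

variable (K : Type*) [Field K] {E : DirGraph} {R : Type*} [NonUnitalRing R] [Module K R]

/-- The linear map on the free algebra which sends a word to the value of `δ` on the set of its
fixed points. -/
noncomputable def freeTrace (δ : E.Vert → R) : FreeNonUnitalAlg K E.Gen →ₗ[K] R :=
  Finsupp.linearCombination K (fun w => rayValue δ (wordRel w).fixed) ∘ₗ
    (MonoidAlgebra.coeffLinearEquiv K).toLinearMap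

variable {K}

theorem freeTrace_word (δ : E.Vert → R) (w : FreeSemigroup E.Gen) :
    freeTrace K δ (word K w) = rayValue δ (wordRel w).fixed := by
  simp [freeTrace, word]

theorem linearMap_ext_word {f g : FreeNonUnitalAlg K E.Gen →ₗ[K] R}
    (h : ∀ w, f (word K w) = g (word K w)) : f = g := by
  refine LinearMap.ext fun x => ?_
  induction x using MonoidAlgebra.induction_linear with
  | zero => rw [map_zero, map_zero]
  | add x y hx hy => rw [map_add, map_add, hx, hy]
  | single w a =>
    have : MonoidAlgebra.single w a = a • word K w := by simp [word]
    rw [this, map_smul, map_smul, h]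

/-- Both sides are bilinear, so two words suffice; these act by monomials, whose fixed points in
either order have equal values. -/
theorem freeTrace_mul_comm (δ : E.Vert → R) (x y : FreeNonUnitalAlg K E.Gen) :
    freeTrace K δ (x * y) = freeTrace K δ (y * x) := by
  have h : ∀ w y, freeTrace K δ (word K w * y) = freeTrace K δ (y * word K w) := fun w =>
    LinearMap.congr_fun (linearMap_ext_word
      (f := freeTrace K δ ∘ₗ LinearMap.mulLeft K (word K w))
      (g := freeTrace K δ ∘ₗ LinearMap.mulRight K (word K w)) fun w' => by
        simp only [LinearMap.comp_apply, LinearMap.mulLeft_apply, LinearMap.mulRight_apply,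
          word_mul, freeTrace_word, map_mul]
        exact SeqRel.rayValue_fixed_mul_comm δ (isMonomial_wordRel w) (isMonomial_wordRel w'))
  exact LinearMap.congr_fun (linearMap_ext_word
    (f := freeTrace K δ ∘ₗ LinearMap.mulRight K y)
    (g := freeTrace K δ ∘ₗ LinearMap.mulLeft K y) fun w => h w y) x

/-- Elements which `freeTrace` does not distinguish, not even after multiplication. -/
def TraceEq (δ : E.Vert → R) (x y : FreeNonUnitalAlg K E.Gen) : Prop :=
  freeTrace K δ x = freeTrace K δ y ∧ ∀ a, freeTrace K δ (a * x) = freeTrace K δ (a * y)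

theorem TraceEq.of_word {δ : E.Vert → R} {x y : FreeNonUnitalAlg K E.Gen}
    (h : freeTrace K δ x = freeTrace K δ y)
    (hw : ∀ w, freeTrace K δ (word K w * x) = freeTrace K δ (word K w * y)) : TraceEq δ x y :=
  ⟨h, LinearMap.congr_fun (linearMap_ext_word
    (f := freeTrace K δ ∘ₗ LinearMap.mulRight K x)
    (g := freeTrace K δ ∘ₗ LinearMap.mulRight K y) hw)⟩

theorem TraceEq.of_wordRel_eq {δ : E.Vert → R} {w w' : FreeSemigroup E.Gen} (h : wordRel w = wordRel w') :
    TraceEq δ (word K w) (word K w') := by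
  refine .of_word ?_ fun v => ?_
  · rw [freeTrace_word, freeTrace_word, h]
  · rw [word_mul, word_mul, freeTrace_word, freeTrace_word, map_mul, map_mul, h]

theorem TraceEq.of_wordRel_eq_zero (δ : E.Vert → R) {w : FreeSemigroup E.Gen} (h : wordRel w = 0) :
    TraceEq δ (word K w) 0 := by
  refine .of_word ?_ fun v => ?_
  · rw [freeTrace_word, h, SeqRel.fixed_zero, rayValue_empty, map_zero]
  · rw [word_mul, freeTrace_word, map_mul, h, SeqRel.mul_zero, SeqRel.fixed_zero, rayValue_empty,
      mul_zero, map_zero]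

theorem TraceEq.smul {δ : E.Vert → R} {x y : FreeNonUnitalAlg K E.Gen} (h : TraceEq δ x y)
    (a : K) : TraceEq δ (a • x) (a • y) := by
  refine ⟨?_, fun b => ?_⟩
  · rw [map_smul, map_smul, h.1]
  · rw [mul_smul_comm, mul_smul_comm, map_smul, map_smul, h.2]

theorem gen_mul_gen (g h : E.Gen) : gen K g * gen K h = word K (.of g * .of h) :=
  word_mul K _ _

/-- Since v and ee* act as identities on rays, multiplying by them only intersects the fixed points
of A with those rays. Either A has no fixed points and all terms vanish, or they form the ray of a
path. -/
theorem rayValue_fixed_mul_vertex {δ : E.Vert → R} (hδ : IsGraphTrace E δ)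
    {A : E.SeqRel} (hA : A.IsMonomial) {v : E.Vert} (hv : E.IsRegular v) :
    rayValue δ (A * genRel (.vertex v)).fixed =
      ∑ e ∈ hv.edges, rayValue δ (A * (genRel (.edge e) * genRel (.ghost e))).fixed := by
  simp only [edge_mul_ghost]
  simp only [genRel, SeqRel.fixed_mul_swap_self]
  have h₀ : A.fixed = ∅ → rayValue δ (A.fixed ∩ E.ray (v, [])) =
      ∑ e ∈ hv.edges, rayValue δ (A.fixed ∩ E.ray (E.src e, [e])) := by
    intro h
    simp [h]
  obtain rfl | ⟨p, q, -, rfl⟩ := hA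
  · exact h₀ rfl
  by_cases h : (p.src, p.edges) = (q.src, q.edges)
  · rw [← h, SeqRel.fixed_swap_self]
    exact rayValue_inter_vertex hδ p hv
  · exact h₀ (SeqRel.fixed_swap_of_ne h)

theorem traceEq_of_rel {δ : E.Vert → R} (hδ : IsGraphTrace E δ) {x y : FreeNonUnitalAlg K E.Gen}
    (h : Rel K E x y) : TraceEq δ x y := by
  cases h with
  | V v w =>
    rw [gen_mul_gen]
    split_ifs with h
    · subst h
      exact .of_wordRel_eq (vertex_mul_swap v [] _)
    · exact .of_wordRel_eq_zero δ (vertex_mul_swap_of_ne h _)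
  | E1_left e =>
    rw [gen_mul_gen]
    exact .of_wordRel_eq (vertex_mul_swap _ _ _)
  | E1_right e =>
    rw [gen_mul_gen]
    exact .of_wordRel_eq (edge_mul_swap e [] _)
  | E2_left e =>
    rw [gen_mul_gen]
    exact .of_wordRel_eq (vertex_mul_swap _ _ _)
  | E2_right e =>
    rw [gen_mul_gen]
    exact .of_wordRel_eq (ghost_mul_swap_nil e _)
  | CK1 e f =>
    rw [gen_mul_gen]
    split_ifs with h
    · subst h
      exact .of_wordRel_eq (ghost_mul_swap_cons e [] _)
    · exact .of_wordRel_eq_zero δ (ghost_mul_swap_cons_of_ne h _ _ _)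
  | CK2 v hv =>
    have hw : ∀ w, freeTrace K δ (word K w * gen K (.vertex v)) =
        freeTrace K δ (word K w * ∑ e ∈ hv.edges, gen K (.edge e) * gen K (.ghost e)) := by
      intro w
      simp only [Finset.mul_sum, map_sum, gen_mul_gen, word_mul, freeTrace_word, map_mul]
      rw [show gen K (Gen.vertex v) = word K (.of (.vertex v)) from rfl, word_mul,
        freeTrace_word, map_mul]
      exact rayValue_fixed_mul_vertex hδ (isMonomial_wordRel w) hv
    refine .of_word ?_ hw
    -- The identity without a left factor follows from the one with left factor v, as v acts
    -- trivially on both v and ee*.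
    have h := hw (.of (.vertex v))
    have hvv : wordRel (.of (.vertex v) * .of (.vertex v)) = wordRel (.of (.vertex v)) :=
      vertex_mul_swap v [] _
    rw [show gen K (Gen.vertex v) = word K (.of (.vertex v)) from rfl, word_mul,
      (TraceEq.of_wordRel_eq hvv).1] at h
    refine h.trans ?_
    simp only [Finset.mul_sum, map_sum, gen_mul_gen, word_mul]
    refine Finset.sum_congr rfl fun e he => (TraceEq.of_wordRel_eq ?_).1
    obtain rfl : E.src e = v := hv.2.mem_toFinset.1 he
    simp only [map_mul, wordRel_of, edge_mul_ghost, vertex_mul_swap]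

theorem traceEq_of_con {δ : E.Vert → R} (hδ : IsGraphTrace E δ) {x y : FreeNonUnitalAlg K E.Gen}
    (h : con K E x y) : TraceEq δ x y := by
  change RingConGen.Rel (SMulRel K E) x y at h
  induction h with
  | of x y h =>
    obtain ⟨a, h⟩ := h
    exact (traceEq_of_rel hδ h).smul a
  | refl x => exact ⟨rfl, fun _ => rfl⟩
  | symm _ ih => exact ⟨ih.1.symm, fun a => (ih.2 a).symm⟩
  | trans _ _ ih₁ ih₂ => exact ⟨ih₁.1.trans ih₂.1, fun a => (ih₁.2 a).trans (ih₂.2 a)⟩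
  | add _ _ ih₁ ih₂ =>
    refine ⟨?_, fun a => ?_⟩
    · rw [map_add, map_add, ih₁.1, ih₂.1]
    · rw [mul_add, mul_add, map_add, map_add, ih₁.2, ih₂.2]
  -- `TraceEq` controls left multiples only; centrality rotates the other factor into that position.
  | @mul w x y z _ _ ih₁ ih₂ =>
    refine ⟨?_, fun a => ?_⟩
    · rw [ih₂.2, freeTrace_mul_comm, ih₁.2, freeTrace_mul_comm]
    · rw [← mul_assoc, ih₂.2, freeTrace_mul_comm, ← mul_assoc, ih₁.2, mul_assoc,
        freeTrace_mul_comm, mul_assoc]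

/-! ### Descent to the Leavitt path algebra, and the bijection. -/

variable (K) in
/-- The trace on the Leavitt path algebra that extends a graph trace. -/
noncomputable def trace (δ : GraphTrace E R) : LPA K E → R :=
  Quotient.lift (freeTrace K δ.1) fun _ _ h => (traceEq_of_con δ.2 h).1

theorem trace_mk (δ : GraphTrace E R) (x : FreeNonUnitalAlg K E.Gen) :
    trace K δ (mk K E x) = freeTrace K δ.1 x := rfl

theorem isTrace_trace (δ : GraphTrace E R) : IsTrace (trace K δ) where
  map_add x y := by
    obtain ⟨x, rfl⟩ := mk_surjective K x
    obtain ⟨y, rfl⟩ := mk_surjective K y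
    exact map_add (freeTrace K δ.1) x y
  central x y := by
    obtain ⟨x, rfl⟩ := mk_surjective K x
    obtain ⟨y, rfl⟩ := mk_surjective K y
    exact freeTrace_mul_comm δ.1 x y

theorem trace_smul (δ : GraphTrace E R) (a : K) (x : LPA K E) :
    trace K δ (a • x) = a • trace K δ x := by
  obtain ⟨x, rfl⟩ := mk_surjective K x
  exact map_smul (freeTrace K δ.1) a x

theorem trace_vertex (δ : GraphTrace E R) (v : E.Vert) : trace K δ (vertex K v) = δ.1 v :=
  (freeTrace_word δ.1 (.of (.vertex v))).trans <| by
    rw [wordRel_of, genRel, SeqRel.fixed_swap_self, rayValue_ray]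
    rfl

theorem trace_path_mul_ghostPath_self (δ : GraphTrace E R) (p : E.Path) :
    trace K δ (path K p * ghostPath K p) = δ.1 p.rng := by
  obtain ⟨w, hw, hw'⟩ := exists_word_path K p
  obtain ⟨x, hx, hx'⟩ := exists_word_ghostPath K p
  rw [← hw, ← hx, ← mk_mul, word_mul, trace_mk, freeTrace_word, map_mul, hw', hx',
    SeqRel.swap_mul_swap, SeqRel.fixed_swap_self, rayValue_ray]
  rfl

theorem trace_path_mul_ghostPath_of_ne (δ : GraphTrace E R) {p q : E.Path} (h : p ≠ q) :
    trace K δ (path K p * ghostPath K q) = 0 := by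
  obtain ⟨w, hw, hw'⟩ := exists_word_path K p
  obtain ⟨x, hx, hx'⟩ := exists_word_ghostPath K q
  rw [← hw, ← hx, ← mk_mul, word_mul, trace_mk, freeTrace_word, map_mul, hw', hx']
  by_cases hr : p.rng = q.rng
  · rw [hr, SeqRel.swap_mul_swap, SeqRel.fixed_swap_of_ne, rayValue_empty]
    exact fun h' => h (DirGraph.Path.ext (congrArg Prod.fst h') (congrArg Prod.snd h'))
  · rw [SeqRel.swap_mul_swap_of_ne hr, SeqRel.fixed_zero, rayValue_empty]

theorem isCanonical_trace (δ : GraphTrace E R) : IsCanonical (trace K δ) := by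
  intro p q
  by_cases h : p = q
  · subst h
    simp [trace_path_mul_ghostPath_self, trace_vertex]
  · simp [h, trace_path_mul_ghostPath_of_ne]

/-- Canonical linear traces are determined by their values on the vertices. -/
theorem canonicalTrace_ext {s t : CanonicalTrace K E R}
    (h : ∀ v, s.1 (vertex K v) = t.1 (vertex K v)) : s = t := by
  let f (t : CanonicalTrace K E R) : FreeNonUnitalAlg K E.Gen →ₗ[K] R :=
    { toFun := fun x => t.1 (mk K E x)
      map_add' := fun x y => t.2.1.map_add (mk K E x) (mk K E y)
      map_smul' := fun a x => t.2.2.1 a (mk K E x) }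
  have hf : f s = f t := by
    refine linearMap_ext_word fun w => ?_
    change s.1 _ = t.1 _
    -- Words span, and on pq* the canonical condition leaves only 0 or the value at r(p).
    obtain hw | ⟨p, q, hw⟩ := mk_word_eq K w
    · rw [hw]
      exact (map_zero (f s)).trans (map_zero (f t)).symm
    · rw [hw, (s.2.2.2 p q).2.2, (t.2.2.2 p q).2.2, h]
  refine Subtype.ext (funext fun x => ?_)
  obtain ⟨x, rfl⟩ := mk_surjective K x
  exact LinearMap.congr_fun hf x

/-- Graph traces correspond to canonical linear traces. -/
noncomputable def graphTraceEquiv : GraphTrace E R ≃ CanonicalTrace K E R where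
  toFun δ := ⟨trace K δ, isTrace_trace δ, trace_smul δ, isCanonical_trace δ⟩
  invFun t := ⟨fun v => t.1 (vertex K v), isGraphTrace_of_isTrace K t.2.1⟩
  left_inv δ := Subtype.ext (funext fun v => trace_vertex δ v)
  right_inv _ := canonicalTrace_ext fun v => trace_vertex _ v

end Trace

end LPA

theorem mainTheorem7 {K : Type*} [Field K] (E : DirGraph) (R : Type*) [NonUnitalRing R]
    [Module K R] [IsScalarTower K R R] [SMulCommClass K R R] :
    ∃ τ : GraphTrace E R ≃ CanonicalTrace K E R,
      (∀ (δ : GraphTrace E R) (v : E.Vert), (τ δ).1 (LPA.vertex K v) = δ.1 v) ∧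
      (∀ (δ : GraphTrace E R) (p q : E.Path),
        (p = q → (τ δ).1 (LPA.path K p * LPA.ghostPath K q) = δ.1 p.rng) ∧
        (p ≠ q → (τ δ).1 (LPA.path K p * LPA.ghostPath K q) = 0)) :=
  ⟨LPA.graphTraceEquiv, fun δ v => LPA.trace_vertex δ v, fun δ p _ =>
    ⟨fun h => h ▸ LPA.trace_path_mul_ghostPath_self δ p,
      fun h => LPA.trace_path_mul_ghostPath_of_ne δ h⟩⟩
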